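/- Let $T$ be a complete, model complete, strongly minimal theory in a countable language; in particular all models of $T$ are infinite. For a model $N$ of $T$, regard $N$ as a pregeometry with closure operator the model-theoretic algebraic closure $\mathrm{acl}$; the dimension of a set is the cardinality of a basis of it, and the dimension of the model $N$ is the dimension of the set $N$. Let $M$ be the countable saturated model of $T$. Assume that the pregeometry of $M$ is flat, that is: (a) it is not disintegrated (it is not the case that $\mathrm{acl}(A)=\bigcup_{a\in A}\mathrm{acl}(\{a\})$ for every nonempty $A\subseteq M$), and (b) for all finite-dimensional algebraically closed sets $E_1,\dots,E_k\subseteq M$, $$\dim\Big(\bigcup_{i=1}^k E_i\Big)\le \sum_{\emptyset\ne s\subseteq\{1,\dots,k\}}(-1)^{|s|+1}\dim\Big(\bigcap_{i\in s}E_i\Big).$$ A circuit is a dependent set of points all of whose proper subsets are independent. Let $n+1$ be the smallest size of a circuit of size greater than $2$ in $M$ (so $n$ is the dimension of the smallest such circuit). If $n>3$, then the prime model of $T$ has dimension $p\ge n$; consequently $T$ has no model of dimension less than $n$, i.e. every model $N$ of $T$ satisfies $\dim N\ge n$. -/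

import Mathlib

/-! Pregeometries. All notions are stated for the closure operator `cl` of a pregeometry. -/

universe u v w

namespace Pregeometry

variable {α : Type w} (cl : Set α → Set α)

/-- No element of `A` lies in the closure of the others. -/
def Indep (A : Set α) : Prop :=
  ∀ a ∈ A, a ∉ cl (A \ {a})

/-- A basis of `A`: a minimal `Y ⊆ A` with `A ⊆ cl Y`. -/
def IsBasis (Y A : Set α) : Prop :=
  Minimal (fun Z : Set α => Z ⊆ A ∧ A ⊆ cl Z) Y

/-- The dimension of `A`: the cardinality of any basis of `A`. (In a pregeometry every set has a
basis and all its bases have the same cardinality, so the infimum is over a singleton.) -/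
noncomputable def dim (A : Set α) : Cardinal.{w} :=
  sInf {κ | ∃ Y : Set α, IsBasis cl Y A ∧ Cardinal.mk Y = κ}

/-- A circuit: a dependent set all of whose proper subsets are independent. -/
def IsCircuit (C : Set α) : Prop :=
  ¬ Indep cl C ∧ ∀ D : Set α, D ⊂ C → Indep cl D

/-- The smallest circuit of size `> 2` has size `n + 1` (in other words, dimension `n`). -/
def IsSmallestCircuitDim (n : ℕ) : Prop :=
  IsLeast {m : ℕ | 2 < m ∧ ∃ C : Set α, IsCircuit cl C ∧ C.ncard = m} (n + 1)

/-- Whatever depends on a (nonempty) set depends on a single element of it. -/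
def IsDisintegrated : Prop :=
  ∀ A : Set α, A.Nonempty → ∀ b ∈ cl A, ∃ a ∈ A, b ∈ cl {a}

/-- The alternating sum of inclusion-exclusion, with dimension in place of cardinality:
`∑_{∅ ≠ s ⊆ {1, …, k}} (-1)^(|s| + 1) dim (⋂_{i ∈ s} E i)`. -/
noncomputable def flatSum {k : ℕ} (E : Fin k → Set α) : ℤ :=
  ∑ s : Finset (Fin k) with s.Nonempty,
    (-1 : ℤ) ^ (s.card + 1) * ((dim cl (⋂ i ∈ s, E i)).toNat : ℤ)

/-- Flatness: not disintegrated, and the dimension of a union of finitely many finite dimensional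
closed sets is bounded by the alternating sum of inclusion-exclusion. -/
def IsFlat : Prop :=
  ¬ IsDisintegrated cl ∧
    ∀ (k : ℕ) (E : Fin k → Set α),
      (∀ i, cl (E i) = E i ∧ dim cl (E i) < Cardinal.aleph0) →
        ((dim cl (⋃ i, E i)).toNat : ℤ) ≤ flatSum cl E

end Pregeometry

namespace FirstOrder.Language

open FirstOrder

section Structures

variable (L : Language.{u, v}) (M : Type w) [L.Structure M]

/-- The model theoretic algebraic closure: `b ∈ acl A` when `b` lies in a finite set that is
definable with parameters from `A`. -/
def acl (A : Set M) : Set M :=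
  {b | ∃ S : Set M, A.Definable₁ L S ∧ S.Finite ∧ b ∈ S}

/-- The dimension of the structure `M` with respect to algebraic closure. -/
noncomputable def modelDim : Cardinal.{w} :=
  Pregeometry.dim (acl L M) Set.univ

/-- `M` is saturated: for `A ⊆ M` with `|A| < |M|`, every set of formulas in one variable with
parameters from `A` that is finitely satisfiable in `M` is realized in `M`. -/
def IsSaturated : Prop :=
  ∀ A : Set M, Cardinal.mk A < Cardinal.mk M →
    ∀ Γ : Set (L[[A]].Formula Unit),
      (∀ Δ : Finset (L[[A]].Formula Unit), (Δ : Set (L[[A]].Formula Unit)) ⊆ Γ →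
        ∃ b : M, ∀ φ ∈ Δ, φ.Realize (fun _ : Unit => b)) →
      ∃ b : M, ∀ φ ∈ Γ, φ.Realize (fun _ : Unit => b)

end Structures

namespace Theory

variable {L : Language.{u, v}} (T : L.Theory)

/-- `T` is a strongly minimal complete theory: all models are infinite, and in every model each
subset definable with parameters is finite or cofinite. -/
def IsStronglyMinimal : Prop :=
  T.IsComplete ∧
    ∀ M : ModelType.{u, v, w} T, Infinite M ∧
      ∀ S : Set M, (Set.univ : Set M).Definable₁ L S → S.Finite ∨ Sᶜ.Finite

/-- `T` is model complete: every embedding between models of `T` is elementary. -/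
def IsModelComplete : Prop :=
  ∀ (M N : ModelType.{u, v, w} T) (f : M ↪[L] N) (k : ℕ) (φ : L.Formula (Fin k)) (x : Fin k → M),
    φ.Realize (f ∘ x) ↔ φ.Realize x

variable {T}

/-- `P` is a prime model of `T`: it embeds elementarily into every model of `T`. -/
def IsPrimeModel (P : ModelType.{u, v, w} T) : Prop :=
  ∀ N : ModelType.{u, v, w} T, Nonempty (P ↪ₑ[L] N)

end Theory

end FirstOrder.Language

/-! The heart is `exists_indep_finite_acl`: some independent set `E` of `n - 1` elements has finite
algebraic closure. If a model had a basis of fewer than `n` elements, that basis would have the type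
of a tuple from `E` (`realize_iff_of_generic`). The model is infinite and algebraic over the basis,
so the closure of that tuple would be infinite too (`infinite_acl_of_realize_iff`), a contradiction.

To find `E`, remove two points `e`, `b` from a circuit of size `n + 1`. Then `e` lies in a finite
fibre `Q(b, ·)` of a relation `Q` over `E`. Suppose `acl E` is infinite. As `b` is generic over `E`,
cofinitely many `y` have a `z` with `Q(y, z)`, hence infinitely many `y` in `acl E` do, and then `z`
is in `acl E` as well. There are no circuits of size between `3` and `n`, so closure inside `E` is
disintegrated: `y` and `z` each depend on one element of `E`. Since `E` has at least three elements,
some `r` in `E` is needed for neither, and one `r` serves infinitely many `y`. Genericity carries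
this back to `b` (`exists_fiber_mem_acl`): some `c` in `Q(b, ·)` is algebraic over `b` and `E \
{r}`. If the fibre is chosen to isolate `e`, the same holds of `e`, which contradicts the
independence of the proper subset `C \ {r}` of the circuit. -/

namespace FirstOrder.Language

open FirstOrder

/-! ### Counting quantifiers. -/

section Counting

variable {L : Language.{u, v}} {α : Type*}

/-- The formula saying that `φ` has at least `k` solutions in its last variable. -/
noncomputable def Formula.atLeast (φ : L.Formula (α ⊕ Unit)) (k : ℕ) : L.Formula α :=
  Formula.iExs (Fin k)
    ((Formula.iInf fun p : {p : Fin k × Fin k // p.1 ≠ p.2} =>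
        ∼((Term.var (Sum.inr p.1.1)).equal (Term.var (Sum.inr p.1.2)))) ⊓
      Formula.iInf fun i : Fin k => φ.relabel (Sum.map id fun _ => i))

theorem natCast_le_encard_iff {X : Type*} {s : Set X} {k : ℕ} :
    (k : ℕ∞) ≤ s.encard ↔ ∃ f : Fin k → X, Function.Injective f ∧ ∀ i, f i ∈ s := by
  constructor
  · intro h
    obtain ⟨t, hts, htk⟩ := Set.exists_subset_encard_eq h
    have hfin : t.Finite := Set.finite_of_encard_eq_coe htk
    have hcard : hfin.toFinset.card = k := by
      rw [hfin.encard_eq_coe_toFinset_card] at htk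
      exact_mod_cast htk
    refine ⟨fun i => (hfin.toFinset.equivFinOfCardEq hcard).symm i, ?_, fun i => hts ?_⟩
    · exact Subtype.val_injective.comp (hfin.toFinset.equivFinOfCardEq hcard).symm.injective
    · exact hfin.mem_toFinset.1 (Subtype.prop _)
  · rintro ⟨f, hf, hs⟩
    have h : (Set.range f).encard ≤ s.encard := Set.encard_le_encard (Set.range_subset_iff.2 hs)
    rwa [← Set.image_univ, hf.encard_image, Set.encard_univ, ENat.card_eq_coe_fintype_card,
      Fintype.card_fin] at h

theorem Formula.realize_atLeast {M : Type*} [L.Structure M] {φ : L.Formula (α ⊕ Unit)} {k : ℕ}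
    {v : α → M} : (φ.atLeast k).Realize v ↔
      (k : ℕ∞) ≤ {x | φ.Realize (Sum.elim v fun _ => x)}.encard := by
  rw [natCast_le_encard_iff, Formula.atLeast, Formula.realize_iExs]
  refine exists_congr fun f => ?_
  simp only [Formula.realize_inf, Formula.realize_iInf, Formula.realize_not,
    Formula.realize_equal, Term.realize_var, Formula.realize_relabel, Sum.elim_inr,
    Set.mem_ofPred_eq]
  refine and_congr ⟨fun h i j hij => ?_, fun h p hp => p.2 (h hp)⟩ (forall_congr' fun i => ?_)
  · by_contra hne
    exact h ⟨(i, j), hne⟩ hij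
  · rw [iff_iff_eq]
    congr 1
    ext x
    rcases x with x | x <;> rfl

end Counting

/-! ### Relations definable over a parameter set. -/

section DefRel

variable (L : Language.{u, v}) {M : Type w} [L.Structure M] {α β : Type*} {A B : Set M}

/-- The relation `P` is definable with parameters from `A`. -/
def DefRel (A : Set M) (P : (α → M) → Prop) : Prop :=
  ∃ φ : L.Formula (A ⊕ α), ∀ v, φ.Realize (Sum.elim (↑) v) ↔ P v

variable {L}

theorem DefRel.and {P Q : (α → M) → Prop} (hP : DefRel L A P) (hQ : DefRel L A Q) :
    DefRel L A fun v => P v ∧ Q v := by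
  obtain ⟨φ, hφ⟩ := hP
  obtain ⟨ψ, hψ⟩ := hQ
  exact ⟨φ ⊓ ψ, fun v => by rw [Formula.realize_inf, hφ, hψ]⟩

theorem DefRel.not {P : (α → M) → Prop} (hP : DefRel L A P) : DefRel L A fun v => ¬ P v := by
  obtain ⟨φ, hφ⟩ := hP
  exact ⟨φ.not, fun v => by rw [Formula.realize_not, hφ]⟩

theorem DefRel.comp {P : (α → M) → Prop} (hP : DefRel L A P) (hAB : A ⊆ B)
    (f : (β → M) → α → M)
    (hf : ∀ i, (∃ j, ∀ v, f v i = v j) ∨ ∃ b ∈ B, ∀ v, f v i = b) :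
    DefRel L B fun v => P (f v) := by
  obtain ⟨φ, hφ⟩ := hP
  have hg : ∀ i, ∃ c : B ⊕ β, ∀ v, f v i = Sum.elim (↑) v c := by
    intro i
    rcases hf i with ⟨j, hj⟩ | ⟨b, hb, hj⟩
    · exact ⟨Sum.inr j, hj⟩
    · exact ⟨Sum.inl ⟨b, hb⟩, hj⟩
  choose g hg using hg
  refine ⟨φ.relabel (Sum.elim (fun a : A => Sum.inl ⟨a, hAB a.2⟩) g), fun v => ?_⟩
  refine Formula.realize_relabel.trans (.trans (iff_of_eq ?_) (hφ _))
  congr 1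
  ext x
  rcases x with x | x
  · rfl
  · exact (hg x v).symm

theorem DefRel.mono {P : (α → M) → Prop} (hP : DefRel L A P) (hAB : A ⊆ B) : DefRel L B P :=
  hP.comp hAB id fun i => .inl ⟨i, fun _ => rfl⟩

/-- Numerical bounds on fibres are first-order, unlike finiteness itself; all later arguments
replace "finite" by "fewer than `k`" for this reason. -/
theorem DefRel.le_encard {P : (α → M) → M → Prop}
    (hP : DefRel L A fun w : α ⊕ Unit → M => P (w ∘ Sum.inl) (w (Sum.inr ()))) (k : ℕ) :
    DefRel L A fun v => (k : ℕ∞) ≤ {x | P v x}.encard := by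
  obtain ⟨φ, hφ⟩ := hP
  refine ⟨(φ.relabel (Equiv.sumAssoc _ _ _).symm).atLeast k, fun v => ?_⟩
  rw [Formula.realize_atLeast, iff_iff_eq]
  congr 2
  ext x
  rw [Set.mem_ofPred_eq, Set.mem_ofPred_eq, Formula.realize_relabel]
  have h : φ.Realize (Sum.elim (↑) (Sum.elim v fun _ => x)) ↔ P v x := hφ _
  rw [← h, iff_iff_eq]
  congr 1
  ext x
  rcases x with x | x | x <;> rfl

theorem DefRel.exists {P : (α → M) → M → Prop}
    (hP : DefRel L A fun w : α ⊕ Unit → M => P (w ∘ Sum.inl) (w (Sum.inr ()))) :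
    DefRel L A fun v => ∃ x, P v x := by
  have h : (fun v => ∃ x, P v x) = fun v => ((1 : ℕ) : ℕ∞) ≤ {x | P v x}.encard := by
    ext v
    rw [Nat.cast_one, Set.one_le_encard_iff_nonempty]
    rfl
  rw [h]
  exact hP.le_encard 1

theorem DefRel.eq_var (i j : α) : DefRel L A fun v : α → M => v i = v j :=
  ⟨(Term.var (Sum.inr i)).equal (Term.var (Sum.inr j)), fun v => by
    simp [Formula.realize_equal]⟩

/-- A relation definable over `insert a A` is a fibre of a relation definable over `A`. -/
theorem DefRel.exists_fiber {k : ℕ} {a : M} {P : (Fin k → M) → Prop}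
    (hP : DefRel L (insert a A) P) :
    ∃ Q : (Fin (k + 1) → M) → Prop, DefRel L A Q ∧
      ∀ v : Fin k → M, Q (Matrix.vecCons a v) ↔ P v := by
  classical
  obtain ⟨φ, hφ⟩ := hP
  let g : ↥(insert a A) ⊕ Fin k → A ⊕ Fin (k + 1) :=
    Sum.elim (fun c => if h : (c : M) = a then Sum.inr 0 else Sum.inl ⟨c, c.2.resolve_left h⟩)
      (fun i => Sum.inr i.succ)
  refine ⟨fun w => (φ.relabel g).Realize (Sum.elim (↑) w), ⟨φ.relabel g, fun _ => Iff.rfl⟩,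
    fun v => ?_⟩
  rw [← hφ]
  refine Formula.realize_relabel.trans (iff_of_eq ?_)
  congr 1
  ext x
  rcases x with x | x
  · by_cases h : (x : M) = a <;> simp [g, h]
  · simp [g]

theorem definable₁_iff_defRel {S : Set M} :
    A.Definable₁ L S ↔ DefRel L A fun v : Fin 1 → M => v 0 ∈ S := by
  rw [Set.Definable₁, Set.definable_iff_exists_formula_sum, DefRel]
  refine exists_congr fun φ => ?_
  rw [Set.ext_iff]
  exact forall_congr' fun v => Iff.comm

theorem mem_acl_iff {b : M} :
    b ∈ acl L M A ↔
      ∃ S : Set M, DefRel L A (fun v : Fin 1 → M => v 0 ∈ S) ∧ S.Finite ∧ b ∈ S := by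
  simp only [acl, Set.mem_ofPred_eq, definable₁_iff_defRel]

end DefRel

/-! ### Closure properties of `acl`. -/

section Pregeometry

variable {L : Language.{u, v}} {M : Type w} [L.Structure M] {A B : Set M} {a b : M}

theorem acl_mono (h : A ⊆ B) : acl L M A ⊆ acl L M B := by
  intro b hb
  obtain ⟨S, hS, hfin, hbS⟩ := mem_acl_iff.1 hb
  exact mem_acl_iff.2 ⟨S, hS.mono h, hfin, hbS⟩

theorem subset_acl : A ⊆ acl L M A := fun a ha =>
  mem_acl_iff.2 ⟨{a}, (DefRel.eq_var (A := A) (0 : Fin 2) 1).comp subset_rfl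
    (fun v => ![v 0, a]) (by
      intro i
      fin_cases i
      exacts [.inl ⟨0, fun _ => rfl⟩, .inr ⟨a, ha, fun _ => rfl⟩]), Set.finite_singleton a, rfl⟩

theorem exists_finite_of_mem_acl (h : b ∈ acl L M A) :
    ∃ F ⊆ A, F.Finite ∧ b ∈ acl L M F := by
  obtain ⟨S, hS, hfin, hbS⟩ := h
  obtain ⟨F, hF, hSF⟩ := Set.definable_iff_finitely_definable.1 hS
  exact ⟨F, hF, F.finite_toSet, S, hSF, hfin, hbS⟩

/-- Let `a` vary over a finite set `R` definable over `A`, keeping only the fibres with fewer than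
`k` elements: their union is finite, definable over `A`, and contains `b`. -/
theorem mem_acl_of_mem_acl_insert (ha : a ∈ acl L M A) (hb : b ∈ acl L M (insert a A)) :
    b ∈ acl L M A := by
  obtain ⟨R, hR, hRfin, haR⟩ := mem_acl_iff.1 ha
  obtain ⟨S, hS, hSfin, hbS⟩ := mem_acl_iff.1 hb
  obtain ⟨Q, hQ, hQS⟩ := hS.exists_fiber
  obtain ⟨k, hk⟩ : ∃ k : ℕ, S.encard < k := by
    rw [hSfin.encard_eq_coe_toFinset_card]
    exact ⟨_, Nat.cast_lt.2 (Nat.lt_succ_self _)⟩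
  have hSa : {x | Q ![a, x]} = S := Set.ext fun x => hQS ![x]
  have hcount : DefRel L A fun v : Fin 1 → M => (k : ℕ∞) ≤ {x | Q ![v 0, x]}.encard := by
    refine DefRel.le_encard (P := fun v x => Q ![v 0, x])
      (hQ.comp subset_rfl (fun w => ![w (Sum.inl 0), w (Sum.inr ())]) ?_) k
    intro i
    fin_cases i
    exacts [.inl ⟨.inl 0, fun _ => rfl⟩, .inl ⟨.inr (), fun _ => rfl⟩]
  have hU : DefRel L A fun v : Fin 1 → M =>
      ∃ y, (y ∈ R ∧ ¬ (k : ℕ∞) ≤ {x | Q ![y, x]}.encard) ∧ Q ![y, v 0] := by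
    refine DefRel.exists
      (P := fun v y => (y ∈ R ∧ ¬ (k : ℕ∞) ≤ {x | Q ![y, x]}.encard) ∧ Q ![y, v 0])
      ((hR.comp subset_rfl (fun w => ![w (Sum.inr ())]) ?_).and
        (hcount.not.comp subset_rfl (fun w => ![w (Sum.inr ())]) ?_) |>.and
          (hQ.comp subset_rfl (fun w => ![w (Sum.inr ()), w (Sum.inl 0)]) ?_))
    · exact fun i => .inl ⟨.inr (), fun _ => by fin_cases i; rfl⟩
    · exact fun i => .inl ⟨.inr (), fun _ => by fin_cases i; rfl⟩
    · intro i
      fin_cases i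
      exacts [.inl ⟨.inr (), fun _ => rfl⟩, .inl ⟨.inl 0, fun _ => rfl⟩]
  refine mem_acl_iff.2 ⟨{z | ∃ y, (y ∈ R ∧ ¬ (k : ℕ∞) ≤ {x | Q ![y, x]}.encard) ∧ Q ![y, z]},
    hU, ?_, a, ⟨haR, ?_⟩, ?_⟩
  · refine (hRfin.biUnion (t := fun y => {z | y ∈ R ∧ ¬ (k : ℕ∞) ≤ {x | Q ![y, x]}.encard ∧
      Q ![y, z]}) fun y _ => ?_).subset ?_
    · by_cases hy : (k : ℕ∞) ≤ {x | Q ![y, x]}.encard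
      · simp [hy]
      · refine (Set.encard_lt_top_iff.1 (lt_of_lt_of_le (not_le.1 hy) le_top)).subset ?_
        exact fun z hz => hz.2.2
    · rintro z ⟨y, ⟨hyR, hy⟩, hz⟩
      exact Set.mem_biUnion hyR ⟨hyR, hy, hz⟩
  · rw [hSa, not_le]
    exact hk
  · exact (hQS ![b]).2 hbS

end Pregeometry

end FirstOrder.Language

namespace FirstOrder.Language

open FirstOrder

/-! ### Minimal structures and exchange. -/

section Minimal

variable (L : Language.{u, v}) (M : Type w) [L.Structure M]

/-- `M` is infinite and each of its subsets definable with parameters is finite or cofinite. -/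
def IsMinimal : Prop :=
  Infinite M ∧ ∀ (A S : Set M), DefRel L A (fun v : Fin 1 → M => v 0 ∈ S) → S.Finite ∨ Sᶜ.Finite

variable {L M} {A B : Set M} {a b c : M}

theorem DefRel.finite_compl (hM : IsMinimal L M) {S : Set M}
    (hS : DefRel L A fun v : Fin 1 → M => v 0 ∈ S) (haS : a ∈ S) (ha : a ∉ acl L M A) :
    Sᶜ.Finite :=
  (hM.2 A S hS).resolve_left fun h => ha (mem_acl_iff.2 ⟨S, hS, h, haS⟩)

theorem mem_of_finite_compl {S : Set M} (hS : DefRel L A fun v : Fin 1 → M => v 0 ∈ S)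
    (h : Sᶜ.Finite) (ha : a ∉ acl L M A) : a ∈ S := by
  by_contra haS
  exact ha (mem_acl_iff.2 ⟨Sᶜ, hS.not, h, haS⟩)

theorem exists_encard_lt {X : Type*} {S : Set X} (h : S.Finite) : ∃ k : ℕ, S.encard < k := by
  rw [h.encard_eq_coe_toFinset_card]
  exact ⟨_, Nat.cast_lt.2 (Nat.lt_succ_self _)⟩

theorem finite_of_not_le_encard {X : Type*} {S : Set X} {k : ℕ} (h : ¬ (k : ℕ∞) ≤ S.encard) :
    S.Finite :=
  Set.encard_lt_top_iff.1 (lt_of_lt_of_le (not_le.1 h) le_top)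

theorem le_encard_of_infinite {X : Type*} {S : Set X} (h : S.Infinite) (k : ℕ) :
    (k : ℕ∞) ≤ S.encard := by
  rw [h.encard_eq]
  exact le_top

/-- If infinitely many members of a family of sets are cofinite, any number of them share a
point. -/
theorem exists_le_encard_setOf_mem {X Y : Type*} [Infinite X] {s : Set Y} (hs : s.Infinite)
    (f : Y → Set X) (hf : ∀ y ∈ s, (f y)ᶜ.Finite) (k : ℕ) :
    ∃ x, (k : ℕ∞) ≤ {y | x ∈ f y}.encard := by
  obtain ⟨g, hg, hgs⟩ := natCast_le_encard_iff.1 (le_encard_of_infinite hs k)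
  obtain ⟨x, hx⟩ := (Set.finite_iUnion fun i => hf _ (hgs i)).exists_notMem
  refine ⟨x, natCast_le_encard_iff.2 ⟨g, hg, fun i => ?_⟩⟩
  by_contra h
  exact hx (Set.mem_iUnion.2 ⟨i, h⟩)

theorem DefRel.swap {W : (Fin 2 → M) → Prop} (hW : DefRel L A W) :
    DefRel L A fun v : Fin 2 → M => W ![v 1, v 0] :=
  hW.comp subset_rfl (fun v => ![v 1, v 0]) (by
    intro i
    fin_cases i
    exacts [.inl ⟨1, fun _ => rfl⟩, .inl ⟨0, fun _ => rfl⟩])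

theorem DefRel.le_encard_fiber {W : (Fin 2 → M) → Prop} (hW : DefRel L A W) (k : ℕ) :
    DefRel L A fun v : Fin 1 → M => (k : ℕ∞) ≤ {x | W ![v 0, x]}.encard :=
  DefRel.le_encard (P := fun v x => W ![v 0, x])
    (hW.comp subset_rfl (fun w => ![w (Sum.inl 0), w (Sum.inr ())]) (by
      intro i
      fin_cases i
      exacts [.inl ⟨.inl 0, fun _ => rfl⟩, .inl ⟨.inr (), fun _ => rfl⟩])) k

theorem DefRel.fiber {W : (Fin 2 → M) → Prop} (hW : DefRel L A W) (a : M) :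
    DefRel L (insert a A) fun v : Fin 1 → M => W ![a, v 0] :=
  hW.comp (Set.subset_insert a A) (fun v => ![a, v 0]) (by
    intro i
    fin_cases i
    exacts [.inr ⟨a, Set.mem_insert a A, fun _ => rfl⟩, .inl ⟨0, fun _ => rfl⟩])

/-- The pairs of `W` whose fibre has fewer than `k` elements. -/
theorem DefRel.and_not_le_encard_fiber {W : (Fin 2 → M) → Prop} (hW : DefRel L A W) (k : ℕ) :
    DefRel L A fun v : Fin 2 → M => W v ∧ ¬ (k : ℕ∞) ≤ {x | W ![v 0, x]}.encard :=
  hW.and ((hW.le_encard_fiber k).not.comp subset_rfl (fun v => ![v 0])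
    fun i => .inl ⟨0, fun _ => by fin_cases i; rfl⟩)

/-- A finite set definable over `insert c A` is a fibre over `c` of a relation definable over `A`
all of whose fibres have fewer than `k` elements. -/
theorem DefRel.exists_fiber_finite {S : Set M}
    (hS : DefRel L (insert c A) fun v : Fin 1 → M => v 0 ∈ S) (hfin : S.Finite) :
    ∃ (W : (Fin 2 → M) → Prop) (k : ℕ), DefRel L A W ∧ (∀ x, W ![c, x] ↔ x ∈ S) ∧
      ∀ y, ¬ (k : ℕ∞) ≤ {x | W ![y, x]}.encard := by
  obtain ⟨Q, hQ, hQS⟩ := hS.exists_fiber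
  obtain ⟨k, hk⟩ := exists_encard_lt hfin
  have hSc : {x | Q ![c, x]} = S := Set.ext fun x => hQS ![x]
  -- Fibres that are too large become empty; the bound `k + 1` is visibly positive, as an empty
  -- fibre requires.
  refine ⟨_, k + 1, hQ.and_not_le_encard_fiber (k + 1), fun x => ⟨fun h => (hQS ![x]).1 h.1,
    fun h => ⟨(hQS ![x]).2 h, ?_⟩⟩, fun y => ?_⟩
  · change ¬ _ ≤ {x | Q ![c, x]}.encard
    rw [hSc, not_le]
    exact hk.trans_le (by exact_mod_cast Nat.le_succ k)
  · intro h
    have hy : ¬ ((k + 1 : ℕ) : ℕ∞) ≤ {x | Q ![y, x]}.encard := by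
      intro h'
      have hemp : {x | Q ![y, x] ∧ ¬ ((k + 1 : ℕ) : ℕ∞) ≤ {x | Q ![y, x]}.encard} = ∅ :=
        Set.eq_empty_of_forall_notMem fun x hx => hx.2 h'
      have h2 := h
      change _ ≤ {x | Q ![y, x] ∧ ¬ ((k + 1 : ℕ) : ℕ∞) ≤ {x | Q ![y, x]}.encard}.encard at h2
      rw [hemp, Set.encard_empty] at h2
      exact absurd h2 (by simp)
    exact hy (h.trans (Set.encard_le_encard fun x hx => hx.1))

/-- The exchange property. -/
theorem mem_acl_insert_comm (hM : IsMinimal L M) (ha : a ∈ acl L M (insert c A))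
    (haA : a ∉ acl L M A) : c ∈ acl L M (insert a A) := by
  obtain ⟨S, hS, hfin, haS⟩ := mem_acl_iff.1 ha
  obtain ⟨W, k, hW, hWS, hWk⟩ := hS.exists_fiber_finite hfin
  have hT : DefRel L (insert a A) fun v : Fin 1 → M => v 0 ∈ {y | W ![y, a]} := hW.swap.fiber a
  -- Otherwise `W(·, a)` is cofinite. So, with one bound `l` on the complements, are infinitely many
  -- `W(·, x)`, because `a` is not algebraic over `A`. Any `k` of these share a point `y`, whose
  -- fibre is then too large.
  by_contra hc
  have hTc := hT.finite_compl hM (a := c) ((hWS a).2 haS) hc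
  obtain ⟨l, hl⟩ := exists_encard_lt hTc
  have hX : DefRel L A fun v : Fin 1 → M =>
      v 0 ∈ {x | ¬ (l : ℕ∞) ≤ {y | ¬ W ![y, x]}.encard} :=
    (hW.swap.not.le_encard_fiber l).not
  have hXinf : {x | ¬ (l : ℕ∞) ≤ {y | ¬ W ![y, x]}.encard}.Infinite := fun hXfin =>
    haA (mem_acl_iff.2 ⟨_, hX, hXfin, not_le.2 hl⟩)
  have := hM.1
  obtain ⟨y, hy⟩ := exists_le_encard_setOf_mem hXinf (fun x => {y | W ![y, x]})
    (fun x hx => finite_of_not_le_encard hx) k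
  exact hWk y hy

end Minimal

/-! ### Independent sets and bases. -/

section Independence

open Pregeometry

variable {L : Language.{u, v}} {M : Type w} [L.Structure M] {A B Y : Set M} {a b c : M}

theorem indep_mono (hA : Indep (acl L M) A) (h : B ⊆ A) : Indep (acl L M) B :=
  fun b hb hb' => hA b (h hb) (acl_mono (Set.sdiff_subset_sdiff_left h) hb')

theorem indep_insert (hM : IsMinimal L M) (hA : Indep (acl L M) A) (hb : b ∉ acl L M A) :
    Indep (acl L M) (insert b A) := by
  have hbA : b ∉ A := fun h => hb (subset_acl h)
  rintro a (rfl | ha) h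
  · rw [Set.insert_sdiff_self_of_notMem hbA] at h
    exact hb h
  · have hne : b ≠ a := fun h => hbA (h ▸ ha)
    rw [← Set.insert_sdiff_singleton_comm hne] at h
    have h' := mem_acl_insert_comm hM h (hA a ha)
    rw [Set.insert_sdiff_singleton, Set.insert_eq_of_mem ha] at h'
    exact hb h'

theorem exists_isBasis_univ (hM : IsMinimal L M) :
    ∃ Y : Set M, IsBasis (acl L M) Y Set.univ := by
  obtain ⟨Y, hY⟩ := zorn_subset {Y : Set M | Indep (acl L M) Y} (by
    intro C hC hchain
    refine ⟨⋃₀ C, ?_, fun s hs => Set.subset_sUnion_of_mem hs⟩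
    intro a ⟨s, hs, has⟩ ha
    -- A dependence uses finitely many elements, so it already occurs in one member of the chain.
    obtain ⟨F, hF, hFfin, haF⟩ := exists_finite_of_mem_acl ha
    have hFa : insert a F ⊆ ⋃₀ C :=
      Set.insert_subset ⟨s, hs, has⟩ (hF.trans Set.sdiff_subset)
    obtain ⟨t, ht, hFt⟩ := DirectedOn.exists_mem_subset_of_finset_subset_biUnion
      (f := id) ⟨s, hs⟩ hchain.directedOn (s := (hFfin.insert a).toFinset) (by simpa [Set.sUnion_eq_biUnion] using hFa)
    rw [Set.Finite.coe_toFinset] at hFt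
    refine hC ht a (hFt (Set.mem_insert a F)) (acl_mono (fun x hx => ?_) haF)
    exact ⟨hFt (Set.mem_insert_of_mem a hx), (hF hx).2⟩)
  refine ⟨Y, ⟨Set.subset_univ Y, fun x _ => ?_⟩, fun Z hZ (hZY : Z ⊆ Y) y hy => ?_⟩
  · by_contra hx
    exact hx (subset_acl (hY.le_of_ge (indep_insert hM hY.prop hx) (Set.subset_insert x Y)
      (Set.mem_insert x Y)))
  · by_contra hyZ
    exact hY.prop y hy (acl_mono
      (show Z ⊆ Y \ {y} from fun z hz => ⟨hZY hz, fun h => hyZ (h ▸ hz)⟩) (hZ.2 (Set.mem_univ y)))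

theorem indep_of_isBasis_univ (h : IsBasis (acl L M) Y Set.univ) : Indep (acl L M) Y := by
  intro y hy hy'
  have hsp : Set.univ ⊆ acl L M (Y \ {y}) := fun x _ => by
    refine mem_acl_of_mem_acl_insert hy' ?_
    rw [Set.insert_sdiff_singleton, Set.insert_eq_of_mem hy]
    exact h.prop.2 (Set.mem_univ x)
  exact (h.le_of_le ⟨Set.subset_univ _, hsp⟩ Set.sdiff_subset hy).2 rfl

end Independence

end FirstOrder.Language

namespace FirstOrder.Language

open FirstOrder

/-! ### Saturation and uniform bounds in definable families. -/

section Saturation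

variable {L : Language.{u, v}} {M : Type w} [L.Structure M] {A : Set M}

theorem IsSaturated.exists_forall (hsat : IsSaturated L M) [Infinite M] (hA : A.Finite)
    {P : ℕ → (Fin 1 → M) → Prop} (hP : ∀ k, DefRel L A (P k))
    (hanti : ∀ k l, k ≤ l → ∀ v, P l v → P k v) (h : ∀ k, ∃ b, P k ![b]) :
    ∃ b, ∀ k, P k ![b] := by
  have hφ : ∀ k, ∃ φ : L[[A]].Formula Unit, ∀ b : M,
      φ.Realize (fun _ : Unit => b) ↔ P k ![b] := by
    intro k
    have h1 : DefRel L A fun v : Unit → M => P k ![v ()] :=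
      (hP k).comp subset_rfl (fun v => ![v ()])
        fun i => .inl ⟨(), fun _ => by fin_cases i; rfl⟩
    have h2 : A.Definable L {v : Unit → M | P k ![v ()]} := by
      obtain ⟨φ, hφ⟩ := h1
      exact Set.definable_iff_exists_formula_sum.2 ⟨φ, Set.ext fun v => (hφ v).symm⟩
    obtain ⟨φ, hφ⟩ := h2
    exact ⟨φ, fun b => (Set.ext_iff.1 hφ fun _ => b).symm⟩
  choose φ hφ using hφ
  obtain ⟨b, hb⟩ := hsat A (hA.lt_aleph0.trans_le (Cardinal.aleph0_le_mk M)) (Set.range φ) (by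
    classical
    intro Δ hΔ
    obtain ⟨s, -, rfl⟩ := Finset.subset_set_image_iff.1 (show (Δ : Set _) ⊆ φ '' Set.univ by
      simpa using hΔ)
    -- The conditions are decreasing, so the one of largest index implies the others.
    obtain ⟨b, hb⟩ := h (s.sup id)
    refine ⟨b, fun ψ hψ => ?_⟩
    obtain ⟨k, hk, rfl⟩ := Finset.mem_image.1 hψ
    exact (hφ k b).2 (hanti k _ (Finset.le_sup (f := id) hk) _ hb))
  exact ⟨b, fun k => (hφ k b).1 (hb _ ⟨k, rfl⟩)⟩

theorem IsSaturated.exists_pair_forall (hsat : IsSaturated L M) [Infinite M] (hA : A.Finite)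
    {R : ℕ → (Fin 2 → M) → Prop} (hR : ∀ k, DefRel L A (R k))
    (hanti : ∀ k l, k ≤ l → ∀ v, R l v → R k v) (h : ∀ k, ∃ b c, R k ![b, c]) :
    ∃ b c, ∀ k, R k ![b, c] := by
  obtain ⟨b, hb⟩ := hsat.exists_forall hA (P := fun k v => ∃ c, R k ![v 0, c])
    (fun k => DefRel.exists (P := fun v c => R k ![v 0, c])
      ((hR k).comp subset_rfl (fun w => ![w (Sum.inl 0), w (Sum.inr ())]) (by
        intro i
        fin_cases i
        exacts [.inl ⟨.inl 0, fun _ => rfl⟩, .inl ⟨.inr (), fun _ => rfl⟩])))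
    (fun k l hkl v ⟨c, hc⟩ => ⟨c, hanti k l hkl _ hc⟩) h
  obtain ⟨c, hc⟩ := hsat.exists_forall (hA.insert b) (P := fun k v => R k ![b, v 0])
    (fun k => (hR k).fiber b) (fun k l hkl v hv => hanti k l hkl _ hv) hb
  exact ⟨b, c, hc⟩

theorem DefRel.le_encard_fst {P : (Fin 3 → M) → Prop} (hP : DefRel L A P) (k : ℕ) :
    DefRel L A fun v : Fin 2 → M => (k : ℕ∞) ≤ {x | P ![x, v 0, v 1]}.encard :=
  DefRel.le_encard (P := fun v x => P ![x, v 0, v 1])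
    (hP.comp subset_rfl (fun w => ![w (Sum.inr ()), w (Sum.inl 0), w (Sum.inl 1)]) (by
      intro i
      fin_cases i
      exacts [.inl ⟨.inr (), fun _ => rfl⟩, .inl ⟨.inl 0, fun _ => rfl⟩,
        .inl ⟨.inl 1, fun _ => rfl⟩])) k

/-- In a definable family, the finite sets and the complements of the cofinite sets are bounded. -/
theorem IsSaturated.exists_bound (hsat : IsSaturated L M) (hM : IsMinimal L M) (hA : A.Finite)
    {P : (Fin 3 → M) → Prop} (hP : DefRel L A P) :
    ∃ K : ℕ, ∀ b c, ¬ (K : ℕ∞) ≤ {x | P ![x, b, c]}.encard ∨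
      ¬ (K : ℕ∞) ≤ {x | ¬ P ![x, b, c]}.encard := by
  have := hM.1
  -- Without a bound, saturation yields one pair `b, c` whose fibre is both infinite and coinfinite.
  by_contra! h
  obtain ⟨b, c, hbc⟩ := hsat.exists_pair_forall hA
    (R := fun k v => (k : ℕ∞) ≤ {x | P ![x, v 0, v 1]}.encard ∧
      (k : ℕ∞) ≤ {x | ¬ P ![x, v 0, v 1]}.encard)
    (fun k => (hP.le_encard_fst k).and (hP.not.le_encard_fst k))
    (fun k l hkl v hv => ⟨(Nat.cast_le.2 hkl).trans hv.1, (Nat.cast_le.2 hkl).trans hv.2⟩) h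
  have hS : DefRel L (A ∪ {b, c}) fun v : Fin 1 → M => v 0 ∈ {x | P ![x, b, c]} :=
    hP.comp Set.subset_union_left (fun v => ![v 0, b, c]) (by
      intro i
      fin_cases i
      exacts [.inl ⟨0, fun _ => rfl⟩, .inr ⟨b, by simp, fun _ => rfl⟩,
        .inr ⟨c, by simp, fun _ => rfl⟩])
  rcases hM.2 _ _ hS with hfin | hfin
  · obtain ⟨k, hk⟩ := exists_encard_lt hfin
    exact absurd (hbc k).1 (not_le.2 hk)
  · obtain ⟨k, hk⟩ := exists_encard_lt hfin
    exact absurd (hbc k).2 (not_le.2 hk)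

end Saturation

/-! ### The smallest circuit and a finite closure. -/

section Circuit

open Pregeometry

variable {L : Language.{u, v}} {M : Type w} [L.Structure M] {A B E : Set M} {a b c e r : M}

/-- Write `Q` as `P(r, ·, ·)` with `P` over `A`. For `y`, `z` algebraic over `A`, `Q(y, z)` says
that `P(x, y, z)` holds for cofinitely many `x`. By the uniform bound `K` this is a condition over
`A` that no longer mentions `r`, so it passes from infinitely many `y` to the generic `b`. -/
theorem exists_fiber_mem_acl (hsat : IsSaturated L M) (hM : IsMinimal L M) (hA : A.Finite)
    (hr : r ∉ acl L M A) (hb : b ∉ acl L M (insert r A)) {Q : (Fin 2 → M) → Prop} {k : ℕ}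
    (hQ : DefRel L (insert r A) Q) (hk : ∀ y, ¬ (k : ℕ∞) ≤ {x | Q ![y, x]}.encard)
    (hinf : {y | y ∈ acl L M A ∧ ∃ z ∈ acl L M A, Q ![y, z]}.Infinite) :
    ∃ c ∈ acl L M (insert b A), Q ![b, c] := by
  have := hM.1
  have hbA : b ∉ acl L M A := fun h => hb (acl_mono (Set.subset_insert r A) h)
  have hrb : r ∉ acl L M (insert b A) := fun h => hb (mem_acl_insert_comm hM h hr)
  obtain ⟨P, hP, hPQ, hPk⟩ : ∃ P : (Fin 3 → M) → Prop, DefRel L A P ∧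
      (∀ y z, P ![r, y, z] ↔ Q ![y, z]) ∧ ∀ x y, ¬ (k : ℕ∞) ≤ {z | P ![x, y, z]}.encard := by
    obtain ⟨P, hP, hPQ⟩ := hQ.exists_fiber
    have hcount : DefRel L A fun v : Fin 2 → M => (k : ℕ∞) ≤ {z | P ![v 0, v 1, z]}.encard :=
      DefRel.le_encard (P := fun v z => P ![v 0, v 1, z])
        (hP.comp subset_rfl (fun w => ![w (Sum.inl 0), w (Sum.inl 1), w (Sum.inr ())]) (by
          intro i
          fin_cases i
          exacts [.inl ⟨.inl 0, fun _ => rfl⟩, .inl ⟨.inl 1, fun _ => rfl⟩,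
            .inl ⟨.inr (), fun _ => rfl⟩])) k
    refine ⟨fun v => P v ∧ ¬ (k : ℕ∞) ≤ {z | P ![v 0, v 1, z]}.encard,
      hP.and (hcount.not.comp subset_rfl (fun v => ![v 0, v 1]) ?_), fun y z => ?_,
      fun x y h => ?_⟩
    · intro i
      fin_cases i
      exacts [.inl ⟨0, fun _ => rfl⟩, .inl ⟨1, fun _ => rfl⟩]
    · have hy : {z | P ![r, y, z]} = {z | Q ![y, z]} := Set.ext fun z => hPQ ![y, z]
      refine ⟨fun h => (hPQ _).1 h.1, fun h => ⟨(hPQ _).2 h, ?_⟩⟩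
      change ¬ _ ≤ {z | P ![r, y, z]}.encard
      rw [hy]
      exact hk y
    · obtain ⟨f, hf, hfP⟩ := natCast_le_encard_iff.1 h
      rcases k with _ | k
      · exact hk r (by simp)
      · exact (hfP 0).2 (natCast_le_encard_iff.2 ⟨f, hf, fun i => (hfP i).1⟩)
  obtain ⟨K, hK⟩ := hsat.exists_bound hM hA hP
  have hG : DefRel L A fun v : Fin 2 → M => ¬ (K : ℕ∞) ≤ {x | ¬ P ![x, v 0, v 1]}.encard :=
    (hP.not.le_encard_fst K).not
  have hfib : ∀ y z, DefRel L (insert z (insert y A)) fun v : Fin 1 → M =>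
      v 0 ∈ {x | P ![x, y, z]} := fun y z =>
    hP.comp ((Set.subset_insert y A).trans (Set.subset_insert z _)) (fun v => ![v 0, y, z]) (by
      intro i
      fin_cases i
      exacts [.inl ⟨0, fun _ => rfl⟩, .inr ⟨y, by simp, fun _ => rfl⟩,
        .inr ⟨z, by simp, fun _ => rfl⟩])
  have hY : DefRel L A fun v : Fin 1 → M =>
      v 0 ∈ {y | ∃ z, ¬ (K : ℕ∞) ≤ {x | ¬ P ![x, y, z]}.encard} :=
    DefRel.exists (P := fun v z => ¬ (K : ℕ∞) ≤ {x | ¬ P ![x, v 0, z]}.encard)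
      (hG.comp subset_rfl (fun w => ![w (Sum.inl 0), w (Sum.inr ())]) (by
        intro i
        fin_cases i
        exacts [.inl ⟨.inl 0, fun _ => rfl⟩, .inl ⟨.inr (), fun _ => rfl⟩]))
  have hYinf : {y | ∃ z, ¬ (K : ℕ∞) ≤ {x | ¬ P ![x, y, z]}.encard}.Infinite := by
    refine hinf.mono ?_
    rintro y ⟨hy, z, hz, hyz⟩
    refine ⟨z, (hK y z).resolve_left fun h => hr ?_⟩
    refine mem_acl_of_mem_acl_insert hy (mem_acl_of_mem_acl_insert
      (acl_mono (Set.subset_insert y A) hz) (mem_acl_iff.2 ⟨_, hfib y z, ?_, (hPQ y z).2 hyz⟩))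
    exact finite_of_not_le_encard h
  obtain ⟨c, hc⟩ := mem_of_finite_compl hY ((hM.2 _ _ hY).resolve_left hYinf) hbA
  have hcb : c ∈ acl L M (insert b A) := by
    refine mem_acl_iff.2 ⟨{z | ¬ (K : ℕ∞) ≤ {x | ¬ P ![x, b, z]}.encard}, hG.fiber b, ?_, hc⟩
    -- Infinitely many such `z` would put `k` of them in a single fibre `P(x, b, ·)`.
    by_contra hCinf
    obtain ⟨x, hx⟩ := exists_le_encard_setOf_mem hCinf (fun z => {x | P ![x, b, z]})
      (fun z hz => finite_of_not_le_encard hz) k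
    exact hPk x b hx
  refine ⟨c, hcb, (hPQ b c).1 ?_⟩
  exact mem_of_finite_compl (S := {x | P ![x, b, c]}) (hfib b c) (finite_of_not_le_encard hc)
    fun h => hrb (mem_acl_of_mem_acl_insert hcb h)

/-- An algebraic element has a smallest finite definable set around it. -/
theorem exists_isolating_set (h : e ∈ acl L M A) :
    ∃ S : Set M, DefRel L A (fun v : Fin 1 → M => v 0 ∈ S) ∧ S.Finite ∧ e ∈ S ∧
      ∀ D : Set M, DefRel L A (fun v : Fin 1 → M => v 0 ∈ D) → (S ∩ D).Nonempty → e ∈ D := by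
  obtain ⟨S, ⟨hS, hfin, he⟩, hmin⟩ := (measure Set.ncard).wf.has_min
    {S : Set M | DefRel L A (fun v : Fin 1 → M => v 0 ∈ S) ∧ S.Finite ∧ e ∈ S} (mem_acl_iff.1 h)
  refine ⟨S, hS, hfin, he, fun D hD ⟨c, hcS, hcD⟩ => ?_⟩
  by_contra heD
  -- If `e` were outside `D`, `S \ D` would be a smaller choice than `S`.
  refine hmin (S \ D) ⟨hS.and hD.not, hfin.subset Set.sdiff_subset, he, heD⟩ ?_
  exact Set.ncard_lt_ncard ⟨Set.sdiff_subset, fun h => (h hcS).2 hcD⟩ hfin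

/-- Below the size of the smallest circuit of size `> 2`, closure is disintegrated. -/
theorem exists_mem_acl_singleton (hM : IsMinimal L M) {n : ℕ}
    (hn : ∀ C : Set M, IsCircuit (acl L M) C → 2 < C.ncard → n + 1 ≤ C.ncard)
    (hE : Indep (acl L M) E) (hfin : E.Finite) (hne : E.Nonempty) (hcard : E.ncard < n)
    (hb : b ∈ acl L M E) : ∃ i ∈ E, b ∈ acl L M {i} := by
  obtain ⟨I, ⟨hIE, hbI⟩, hmin⟩ := (measure Set.ncard).wf.has_min
    {I : Set M | I ⊆ E ∧ b ∈ acl L M I} ⟨E, subset_rfl, hb⟩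
  have hIfin := hfin.subset hIE
  have hproper : ∀ J, J ⊂ I → b ∉ acl L M J := fun J hJ hbJ =>
    hmin J ⟨hJ.subset.trans hIE, hbJ⟩ (Set.ncard_lt_ncard hJ hIfin)
  rcases Nat.lt_or_ge 1 I.ncard with hI | hI
  · exfalso
    have hbI' : b ∉ I := fun h => by
      refine hproper {b} ⟨Set.singleton_subset_iff.2 h, fun h' => ?_⟩ (subset_acl rfl)
      have := Set.ncard_le_ncard h'
      rw [Set.ncard_singleton] at this
      omega
    -- By minimality of `I`, adding `b` gives a circuit; its size is between `3` and `n`.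
    have hC : IsCircuit (acl L M) (insert b I) := by
      refine ⟨fun h => h b (Set.mem_insert b I) ?_, fun D hD => ?_⟩
      · rwa [Set.insert_sdiff_self_of_notMem hbI']
      · by_cases hbD : b ∈ D
        · have hDI : D \ {b} ⊆ I := fun x hx => (hD.subset hx.1).resolve_left hx.2
          have hDI' : D \ {b} ⊂ I := ⟨hDI, fun h => hD.2
            (Set.insert_subset hbD (h.trans Set.sdiff_subset))⟩
          have := indep_insert hM (indep_mono hE (hDI.trans hIE)) (hproper _ hDI')
          rwa [Set.insert_sdiff_singleton, Set.insert_eq_of_mem hbD] at this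
        · exact indep_mono hE fun x hx => hIE
            ((hD.subset hx).resolve_left fun h => hbD (h ▸ hx))
    have h1 := Set.ncard_insert_of_notMem hbI' hIfin
    have h2 := Set.ncard_le_ncard hIE hfin
    have := hn _ hC (by omega)
    omega
  · rcases (Set.ncard_le_one_iff_eq hIfin).1 hI with rfl | ⟨i, rfl⟩
    · obtain ⟨i, hi⟩ := hne
      exact ⟨i, hi, acl_mono (Set.empty_subset _) hbI⟩
    · exact ⟨i, hIE rfl, hbI⟩

/-- If the smallest circuit of size `> 2` has dimension `n > 3`, some `n - 1` independent elements
have finite algebraic closure. -/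
theorem exists_indep_finite_acl (hsat : IsSaturated L M) (hM : IsMinimal L M) {n : ℕ}
    (hn : IsSmallestCircuitDim (acl L M) n) (h3 : 3 < n) :
    ∃ E : Set M, E.Finite ∧ E.ncard + 1 = n ∧ Indep (acl L M) E ∧ (acl L M E).Finite := by
  obtain ⟨⟨-, C, hC, hCn⟩, hleast⟩ := hn
  have hCfin : C.Finite := Set.finite_of_ncard_pos (by omega)
  obtain ⟨e, he, heC⟩ : ∃ e ∈ C, e ∈ acl L M (C \ {e}) := by
    by_contra! h
    exact hC.1 h
  have hBn := Set.ncard_sdiff_singleton_add_one he hCfin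
  obtain ⟨b, hb⟩ : (C \ {e}).Nonempty := Set.nonempty_of_ncard_ne_zero (by omega)
  set E := (C \ {e}) \ {b} with hEdef
  have hBfin : (C \ {e}).Finite := hCfin.subset Set.sdiff_subset
  have hBE : insert b E = C \ {e} := by
    rw [hEdef, Set.insert_sdiff_singleton, Set.insert_eq_of_mem hb]
  have hEn := Set.ncard_sdiff_singleton_add_one hb hBfin
  rw [← hEdef] at hEn
  have hBC : C \ {e} ⊂ C := ⟨Set.sdiff_subset, fun h => (h he).2 rfl⟩
  have hB := hC.2 _ hBC
  have hE : Indep (acl L M) E := indep_mono hB Set.sdiff_subset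
  have hEfin : E.Finite := hBfin.subset Set.sdiff_subset
  have hbE : b ∉ acl L M E := hB b hb
  refine ⟨E, hEfin, by omega, hE, ?_⟩
  by_contra hinf
  rw [← hBE] at heC
  obtain ⟨S, hS, hSfin, heS, hSmin⟩ := exists_isolating_set heC
  obtain ⟨Q, k, hQ, hQS, hk⟩ := hS.exists_fiber_finite hSfin
  have hY : DefRel L E fun v : Fin 1 → M => v 0 ∈ {y | ∃ z, Q ![y, z]} :=
    DefRel.exists (P := fun v z => Q ![v 0, z])
      (hQ.comp subset_rfl (fun w => ![w (Sum.inl 0), w (Sum.inr ())]) (by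
        intro i
        fin_cases i
        exacts [.inl ⟨.inl 0, fun _ => rfl⟩, .inl ⟨.inr (), fun _ => rfl⟩]))
  have hYfin := hY.finite_compl hM ⟨e, (hQS e).2 heS⟩ hbE
  have hT : (acl L M E ∩ {y | ∃ z, Q ![y, z]}).Infinite := by
    intro h
    refine hinf ((h.union hYfin).subset fun y hy => ?_)
    by_cases hy' : y ∈ {y | ∃ z, Q ![y, z]}
    · exact .inl ⟨hy, hy'⟩
    · exact .inr hy'
  have hdis : ∀ x ∈ acl L M E, ∃ i ∈ E, x ∈ acl L M {i} := fun x hx =>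
    exists_mem_acl_singleton hM (fun D hD hD2 => hleast ⟨hD2, D, hD, rfl⟩) hE hEfin
      (Set.nonempty_of_ncard_ne_zero (by omega)) (by omega) hx
  have hcover : acl L M E ∩ {y | ∃ z, Q ![y, z]} ⊆
      ⋃ r ∈ E, {y | y ∈ acl L M (E \ {r}) ∧ ∃ z ∈ acl L M (E \ {r}), Q ![y, z]} := by
    rintro y ⟨hy, z, hz⟩
    have hzE : z ∈ acl L M E := mem_acl_of_mem_acl_insert hy
      (mem_acl_iff.2 ⟨{z | Q ![y, z]}, hQ.fiber y, finite_of_not_le_encard (hk y), hz⟩)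
    obtain ⟨i, hi, hyi⟩ := hdis y hy
    obtain ⟨j, hj, hzj⟩ := hdis z hzE
    -- Here `3 < n` is needed: `E` has `n - 1 ≥ 3` elements.
    obtain ⟨r, hr, hrij⟩ : ∃ r ∈ E, r ∉ ({i, j} : Set M) := by
      by_contra! h
      have h1 := Set.ncard_le_ncard (show E ⊆ {i, j} from h)
      have h2 := Set.ncard_insert_le i {j}
      rw [Set.ncard_singleton] at h2
      omega
    simp only [Set.mem_insert_iff, Set.mem_singleton_iff, not_or] at hrij
    refine Set.mem_biUnion hr ⟨acl_mono ?_ hyi, z, acl_mono ?_ hzj, hz⟩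
    · exact Set.singleton_subset_iff.2 ⟨hi, fun h => hrij.1 h.symm⟩
    · exact Set.singleton_subset_iff.2 ⟨hj, fun h => hrij.2 h.symm⟩
  obtain ⟨r, hr, hrinf⟩ : ∃ r ∈ E,
      {y | y ∈ acl L M (E \ {r}) ∧ ∃ z ∈ acl L M (E \ {r}), Q ![y, z]}.Infinite := by
    by_contra! h
    exact hT ((hEfin.biUnion fun r hr => h r hr).subset hcover)
  have hrE : insert r (E \ {r}) = E := by
    rw [Set.insert_sdiff_singleton, Set.insert_eq_of_mem hr]
  obtain ⟨c, hc, hbc⟩ := exists_fiber_mem_acl hsat hM (hEfin.subset Set.sdiff_subset) (hE r hr)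
    (hrE.symm ▸ hbE) (hrE.symm ▸ hQ) hk hrinf
  obtain ⟨D, hD, hDfin, hcD⟩ := mem_acl_iff.1 hc
  have heD := hSmin D (hD.mono (Set.insert_subset_insert Set.sdiff_subset))
    ⟨c, (hQS c).1 hbc, hcD⟩
  have heE : e ∉ E := fun h => h.1.2 rfl
  have heb : e ≠ b := fun h => hb.2 h.symm
  -- This set omits `r`, so it is independent; yet `e` is algebraic over the rest of it by `heD`.
  have hproper : insert e (insert b (E \ {r})) ⊂ C := by
    refine ⟨Set.insert_subset he (Set.insert_subset hb.1 fun x hx => hx.1.1.1), fun h => ?_⟩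
    rcases h hr.1.1 with h | h | h
    · exact heE (h ▸ hr)
    · exact hr.2 h
    · exact h.2 rfl
  refine hC.2 _ hproper e (Set.mem_insert _ _) ?_
  rw [Set.insert_sdiff_self_of_notMem]
  · exact mem_acl_iff.2 ⟨D, hD, hDfin, heD⟩
  · rintro (h | h)
    exacts [heb h, heE h.1]

end Circuit

end FirstOrder.Language

namespace FirstOrder.Language

open FirstOrder

/-! ### Types of independent tuples. -/

section GenericType

variable {L : Language.{u, v}} {M N : Type w} [L.Structure M] [L.Structure N] {m : ℕ}

theorem defRel_realize {A : Set M} {ι : Type*} {y : ι → M} (hy : ∀ i, y i ∈ A)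
    (φ : L.Formula (ι ⊕ Unit)) :
    DefRel L A fun v : Fin 1 → M => v 0 ∈ {x | φ.Realize (Sum.elim y fun _ => x)} := by
  refine ⟨φ.relabel (Sum.map (fun i => ⟨y i, hy i⟩) fun _ => 0), fun v => ?_⟩
  refine Formula.realize_relabel.trans (iff_of_eq ?_)
  change _ = φ.Realize (Sum.elim y fun _ => v 0)
  congr 1
  ext x
  rcases x with x | x <;> rfl

theorem DefRel.exists_formula {ι : Type*} {y : ι → M} {S : Set M}
    (hS : DefRel L (Set.range y) fun v : Fin 1 → M => v 0 ∈ S) :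
    ∃ φ : L.Formula (ι ⊕ Unit), {x | φ.Realize (Sum.elim y fun _ => x)} = S := by
  obtain ⟨φ, hφ⟩ := hS
  have hg : ∀ a : Set.range y, ∃ i, y i = a := fun a => a.2
  choose g hg using hg
  refine ⟨φ.relabel (Sum.map g fun _ => ()), Set.ext fun x => ?_⟩
  refine .trans (Formula.realize_relabel.trans (iff_of_eq ?_)) (hφ ![x])
  congr 1
  ext a
  rcases a with a | a
  · exact hg a
  · fin_cases a
    rfl

/-- Over the first `m` coordinates, a formula true of the generic last one has fewer than `l`
non-solutions. This is a property of those coordinates alone, so it transfers to `e`, whose last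
coordinate is generic too. -/
theorem realize_of_generic (hN : IsMinimal L N) {y : Fin (m + 1) → N} {e : Fin (m + 1) → M}
    (hy : y (Fin.last m) ∉ acl L N (y '' {j | j < Fin.last m}))
    (he : e (Fin.last m) ∉ acl L M (e '' {j | j < Fin.last m}))
    (h : ∀ φ : L.Formula (Fin m),
      φ.Realize (fun i => y i.castSucc) ↔ φ.Realize fun i => e i.castSucc)
    (φ : L.Formula (Fin (m + 1))) (hφ : φ.Realize y) : φ.Realize e := by
  let ψ : L.Formula (Fin m ⊕ Unit) :=
    φ.relabel (Fin.lastCases (motive := fun _ => Fin m ⊕ Unit) (Sum.inr ()) Sum.inl)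
  have hψ : ∀ {K : Type w} [L.Structure K] (z : Fin (m + 1) → K),
      ψ.Realize (Sum.elim (fun i => z i.castSucc) fun _ => z (Fin.last m)) ↔ φ.Realize z := by
    intro K _ z
    refine Formula.realize_relabel.trans (iff_of_eq ?_)
    congr 1
    ext i
    refine Fin.lastCases ?_ (fun i => ?_) i <;> simp
  have hmem : ∀ {K : Type w} (z : Fin (m + 1) → K) (i : Fin m),
      z i.castSucc ∈ z '' {j | j < Fin.last m} := fun z i => ⟨_, Fin.castSucc_lt_last i, rfl⟩
  have hfin := (defRel_realize (hmem y) ψ).finite_compl hN ((hψ y).2 hφ) hy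
  obtain ⟨l, hl⟩ := exists_encard_lt hfin
  have hcount : ¬ (ψ.not.atLeast l).Realize fun i => y i.castSucc := by
    rw [Formula.realize_atLeast, not_le]
    exact hl
  rw [h, Formula.realize_atLeast] at hcount
  exact (hψ e).1 (mem_of_finite_compl
    (S := {x | ψ.Realize (Sum.elim (fun i => e i.castSucc) fun _ => x)}) (defRel_realize (hmem e) ψ)
    (finite_of_not_le_encard hcount) he)

/-- Independent tuples in minimal models of a complete theory have the same type. -/
theorem realize_iff_of_generic {T : L.Theory} (hT : T.IsComplete) [N ⊨ T] [M ⊨ T]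
    (hN : IsMinimal L N) (hM : IsMinimal L M) :
    ∀ {m : ℕ} {y : Fin m → N} {e : Fin m → M},
      (∀ i, y i ∉ acl L N (y '' {j | j < i})) → (∀ i, e i ∉ acl L M (e '' {j | j < i})) →
      ∀ φ : L.Formula (Fin m), φ.Realize y ↔ φ.Realize e
  | 0, y, e, _, _, φ => by
    have hsent : ∀ {K : Type w} [L.Structure K] (z : Fin 0 → K),
        φ.Realize z ↔ K ⊨ (φ.relabel Fin.elim0 : L.Sentence) := fun z => by
      rw [Sentence.Realize]
      refine .symm (Formula.realize_relabel.trans (iff_of_eq ?_))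
      congr 1
      ext i
      exact i.elim0
    have := hN.1
    have := hM.1
    rw [hsent, hsent, hT.realize_sentence_iff, hT.realize_sentence_iff]
  | m + 1, y, e, hy, he, φ => by
    have hinit : ∀ {K : Type w} [L.Structure K] (z : Fin (m + 1) → K),
        (∀ i, z i ∉ acl L K (z '' {j | j < i})) →
        ∀ i : Fin m, z i.castSucc ∉ acl L K ((fun i => z i.castSucc) '' {j | j < i}) := by
      intro K _ z hz i h
      refine hz i.castSucc (acl_mono ?_ h)
      rintro _ ⟨j, hj, rfl⟩
      exact ⟨_, Fin.castSucc_lt_castSucc_iff.2 hj, rfl⟩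
    have ih := realize_iff_of_generic hT hN hM (hinit y hy) (hinit e he)
    exact ⟨realize_of_generic hN (hy _) (he _) ih φ,
      realize_of_generic hM (he _) (hy _) (fun ψ => (ih ψ).symm) φ⟩

/-- Any `k` elements of `N` lie in one finite set definable over `y`, the union of finite sets
around each. Its having at least `k` and fewer than `l` elements is part of the type of `y`, so
`acl` of `e` has at least `k` elements, for every `k`. -/
theorem infinite_acl_of_realize_iff [Infinite N] {ι : Type*} {y : ι → N} {e : ι → M}
    (h : ∀ φ : L.Formula ι, φ.Realize y ↔ φ.Realize e)
    (hy : ∀ x, x ∈ acl L N (Set.range y)) : (acl L M (Set.range e)).Infinite := by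
  intro hfin
  obtain ⟨k, hk⟩ := exists_encard_lt hfin
  obtain ⟨f, hf, -⟩ := natCast_le_encard_iff.1
    (le_encard_of_infinite (Set.infinite_univ (α := N)) k)
  have hψ : ∀ i, ∃ ψ : L.Formula (ι ⊕ Unit),
      {x | ψ.Realize (Sum.elim y fun _ => x)}.Finite ∧
        ψ.Realize (Sum.elim y fun _ => f i) := by
    intro i
    obtain ⟨S, hS, hSfin, hi⟩ := mem_acl_iff.1 (hy (f i))
    obtain ⟨ψ, rfl⟩ := hS.exists_formula
    exact ⟨ψ, hSfin, hi⟩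
  choose ψ hψfin hψf using hψ
  have hθ : {x | (Formula.iSup ψ).Realize (Sum.elim y fun _ => x)}.Finite := by
    refine (Set.finite_iUnion hψfin).subset fun x hx => ?_
    exact Set.mem_iUnion.2 (Formula.realize_iSup.1 hx)
  obtain ⟨l, hl⟩ := exists_encard_lt hθ
  have hge : ((Formula.iSup ψ).atLeast k).Realize y :=
    Formula.realize_atLeast.2 (natCast_le_encard_iff.2
      ⟨f, hf, fun i => Formula.realize_iSup.2 ⟨i, hψf i⟩⟩)
  have hlt : ¬ ((Formula.iSup ψ).atLeast l).Realize y := by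
    rw [Formula.realize_atLeast, not_le]
    exact hl
  rw [h, Formula.realize_atLeast] at hge hlt
  refine not_le.2 hk (hge.trans (Set.encard_le_encard fun x hx => ?_))
  exact mem_acl_iff.2 ⟨_, defRel_realize (fun i => Set.mem_range_self i) _,
    finite_of_not_le_encard hlt, hx⟩

end GenericType

/-! ### The lower bound on the dimension of models. -/

theorem Theory.IsStronglyMinimal.isMinimal {L : Language.{u, v}} {T : L.Theory}
    (hT : Theory.IsStronglyMinimal.{u, v, w} T) (M : Theory.ModelType.{u, v, w} T) :
    IsMinimal L M :=
  ⟨(hT.2 M).1, fun A S hS =>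
    (hT.2 M).2 S (definable₁_iff_defRel.2 (hS.mono (Set.subset_univ A)))⟩

theorem exists_enumeration {L : Language.{u, v}} {M : Type w} [L.Structure M] {Y : Set M}
    (hY : Pregeometry.Indep (acl L M) Y) (hfin : Y.Finite) {m : ℕ} (hm : Y.ncard = m) :
    ∃ y : Fin m → M, Set.range y = Y ∧ ∀ i, y i ∉ acl L M (y '' {j | j < i}) := by
  have := hfin.to_subtype
  let f : Fin m ≃ Y := (Finite.equivFinOfCardEq ((Nat.card_coe_set_eq Y).trans hm)).symm
  refine ⟨fun i => f i, ?_, fun i h => hY _ (f i).2 (acl_mono ?_ h)⟩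
  · rw [show (fun i => (f i : M)) = Subtype.val ∘ f from rfl, f.surjective.range_comp,
      Subtype.range_coe]
  · rintro _ ⟨j, hj, rfl⟩
    refine ⟨(f j).2, fun h => (ne_of_lt hj) (f.injective (Subtype.ext h))⟩

theorem le_modelDim {L : Language.{u, v}} {T : L.Theory}
    (hT : Theory.IsStronglyMinimal.{u, v, w} T) (M N : Theory.ModelType.{u, v, w} T)
    (hsat : IsSaturated L M) {n : ℕ} (hn : Pregeometry.IsSmallestCircuitDim (acl L M) n)
    (h3 : 3 < n) : (n : Cardinal.{w}) ≤ modelDim L N := by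
  by_contra! hlt
  have hM := hT.isMinimal M
  have hN := hT.isMinimal N
  obtain ⟨E, hEfin, hEn, hE, hacl⟩ := exists_indep_finite_acl hsat hM hn h3
  obtain ⟨Y₀, hY₀⟩ := exists_isBasis_univ hN
  -- The infimum defining the dimension is attained, so a basis of that size is at hand without
  -- comparing bases.
  obtain ⟨Y, hY, hYcard⟩ := csInf_mem (s := {κ | ∃ Y : Set N,
    Pregeometry.IsBasis (acl L N) Y Set.univ ∧ Cardinal.mk Y = κ}) ⟨_, Y₀, hY₀, rfl⟩
  change _ = modelDim L N at hYcard
  rw [← hYcard] at hlt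
  have hYfin : Y.Finite := Cardinal.lt_aleph0_iff_set_finite.1 (hlt.trans Cardinal.natCast_lt_aleph0)
  have hYn : Y.ncard < n := by
    rw [← Set.cast_ncard hYfin] at hlt
    exact_mod_cast hlt
  -- The basis may have fewer than `n - 1` elements; a subset of `E` of the same size still has
  -- finite closure.
  obtain ⟨E', hE'E, hE'⟩ := Set.exists_subset_card_eq (s := E) (n := Y.ncard) (by omega)
  obtain ⟨y, hyY, hy⟩ := exists_enumeration (indep_of_isBasis_univ hY) hYfin rfl
  obtain ⟨e, heE, he⟩ := exists_enumeration (indep_mono hE hE'E) (hEfin.subset hE'E) hE'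
  have := hN.1
  have hinf := infinite_acl_of_realize_iff (realize_iff_of_generic hT.1 hN hM hy he)
    fun x => hyY.symm ▸ hY.prop.2 (Set.mem_univ x)
  rw [heE] at hinf
  exact hinf (hacl.subset (acl_mono hE'E))

end FirstOrder.Language

theorem mainTheorem10 (L : FirstOrder.Language.{u, v}) [Countable L.Symbols]
    (T : L.Theory)
    (hsm : FirstOrder.Language.Theory.IsStronglyMinimal.{u, v, w} T)
    (hmc : FirstOrder.Language.Theory.IsModelComplete.{u, v, w} T)
    (M : FirstOrder.Language.Theory.ModelType.{u, v, w} T) (hcount : Countable M)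
    (hsat : FirstOrder.Language.IsSaturated L M)
    (hflat : Pregeometry.IsFlat (FirstOrder.Language.acl L M))
    (n : ℕ) (hn : Pregeometry.IsSmallestCircuitDim (FirstOrder.Language.acl L M) n)
    (h3 : 3 < n) :
    (∀ P : FirstOrder.Language.Theory.ModelType.{u, v, w} T,
      FirstOrder.Language.Theory.IsPrimeModel P →
        (n : Cardinal.{w}) ≤ FirstOrder.Language.modelDim L P) ∧
    (∀ N : FirstOrder.Language.Theory.ModelType.{u, v, w} T,
      (n : Cardinal.{w}) ≤ FirstOrder.Language.modelDim L N) := by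
  have hle := fun N => FirstOrder.Language.le_modelDim hsm M N hsat hn h3
  exact ⟨fun P _ => hle P, hle⟩
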